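/- A planar convex body is a compact convex set $K\subset\mathbb R^2$ with non-empty interior. Write $|\cdot|$ for area, $d_{\mathcal H}$ for the Hausdorff distance, $K\,\Delta\,E$ for the symmetric difference, and $\omega(K)$ for the minimal width of $K$, i.e. the minimum over all directions of the distance between the two parallel supporting lines of $K$ orthogonal to that direction. For a planar convex body $K$ put $$\alpha(K):=\min\left\{\frac{d_{\mathcal H}(K,E)}{\omega(E)} : E \text{ an equilateral triangle},\ \omega(E)=\omega(K)\right\},$$ $$\mathcal A(K):=\min\left\{\frac{|K\,\Delta\,E|}{\omega(E)^2} : E \text{ an equilateral triangle},\ \omega(E)=\omega(K)\right\},$$ where triangles are taken with their interior. Then, for every planar convex body $K$, both minima are attained and $$\frac{1}{25\sqrt5}\,\alpha(K)\ \le\ \mathcal A(K)\ \le\ (3\sqrt3+2)\,\alpha(K).$$ Thus the Hausdorff asymmetry $\alpha$ and the Fraenkel asymmetry $\mathcal A$ with respect to equilateral triangles are equivalent. -/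

import Mathlib

open MeasureTheory
open scoped symmDiff

/-- The Euclidean plane. -/
abbrev Plane : Type := EuclideanSpace ℝ (Fin 2)

/-- The width of `K` in the direction `u`: for a unit vector `u`, the length of the orthogonal
projection of `K` onto the line spanned by `u`, which is the distance between the two supporting
lines of `K` orthogonal to `u`. -/
noncomputable def directionalWidth (K : Set Plane) (u : Plane) : ℝ :=
  sSup ((fun x => inner ℝ u x) '' K) - sInf ((fun x => inner ℝ u x) '' K)

/-- The minimal width `ω(K)`: the least directional width over all unit directions. -/
noncomputable def minimalWidth (K : Set Plane) : ℝ :=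
  ⨅ u : Metric.sphere (0 : Plane) 1, directionalWidth K u

/-- `E` is a (full, nondegenerate) equilateral triangle: the convex hull of the vertices of a
triangle with equal sides. -/
def IsEquilateralTriangle (E : Set Plane) : Prop :=
  ∃ T : Affine.Triangle ℝ Plane, T.Equilateral ∧ E = convexHull ℝ (Set.range T.points)

/-- The values `d_H(K, E) / ω(E)`, for `E` an equilateral triangle with `ω(E) = ω(K)`. -/
def hausdorffRatios (K : Set Plane) : Set ℝ :=
  {t | ∃ E : Set Plane, IsEquilateralTriangle E ∧ minimalWidth E = minimalWidth K ∧
    t = Metric.hausdorffDist K E / minimalWidth E}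

/-- The values `|K ∆ E| / ω(E)²`, for `E` an equilateral triangle with `ω(E) = ω(K)`. -/
def fraenkelRatios (K : Set Plane) : Set ℝ :=
  {t | ∃ E : Set Plane, IsEquilateralTriangle E ∧ minimalWidth E = minimalWidth K ∧
    t = (volume : Measure Plane).real (K ∆ E) / minimalWidth E ^ 2}

/-- The Hausdorff asymmetry `α(K)` with respect to equilateral triangles. -/
noncomputable def hausdorffAsymmetry (K : Set Plane) : ℝ :=
  sInf (hausdorffRatios K)

/-- The Fraenkel asymmetry `𝒜(K)` with respect to equilateral triangles. -/
noncomputable def fraenkelAsymmetry (K : Set Plane) : ℝ :=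
  sInf (fraenkelRatios K)

/-! An equilateral triangle of height `w` is described by its centre `c` and three unit outer
normals `u i` with sum zero (`IsTripod`). Its minimal width is `w`, so the competitors for a body
`K` of width `w` are exactly the pairs `(c, u)`. The tripods form a compact set, both functionals
are continuous in `(c, u)`, and a far-away centre never beats a fixed competitor; hence both minima
exist.

Upper bound: let `d` be the Hausdorff distance from `K` to a triangle `E`. Then `K` lies between the
concentric triangles of heights `w - 3d` and `w + 3d`. If `3d < w`, these differ in area by `4√3 w
d`. If `w ≤ 3d`, adding `|E|` to the estimate of `|K|` by width times diameter suffices; this case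
produces the constant `3√3 + 2`.

Lower bound: let `S = |K ∆ E|`. If `S < |E|` and `K` reaches a distance `t` beyond a side of `E`,
convexity makes the strip of depth `t/3` inside that side have area at most `S` (`volume_strip_le`).
This forces `t ≤ 3√3 S / w`. So `K` lies in a slightly enlarged triangle, and since its width is
still `w`, it must come near every vertex of `E` (`hausdorffDist_le_of_subset`). If `S ≥ |E|`, a
triangle centred at a point of `K` is close enough, because the diameter of `K` is at most `4|K|/w`.
The two cases give the factors `6√3` and `8`, both well below `25√5`. -/

/-! ### Coordinates and area in the plane -/

lemma Plane.inner_eq (x y : Plane) : inner ℝ x y = x 0 * y 0 + x 1 * y 1 := by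
  simp [PiLp.inner_apply, Fin.sum_univ_two, mul_comm]

lemma Plane.norm_sq_eq (x : Plane) : ‖x‖ ^ 2 = x 0 ^ 2 + x 1 ^ 2 := by
  rw [← real_inner_self_eq_norm_sq, Plane.inner_eq]; ring

/-- Rotation of the plane by a right angle. -/
noncomputable def Plane.rot (x : Plane) : Plane := !₂[-x 1, x 0]

@[simp] lemma Plane.rot_apply_zero (x : Plane) : x.rot 0 = -x 1 := rfl
@[simp] lemma Plane.rot_apply_one (x : Plane) : x.rot 1 = x 0 := rfl

lemma Plane.norm_rot (x : Plane) : ‖x.rot‖ = ‖x‖ := by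
  rw [← sq_eq_sq₀ (norm_nonneg _) (norm_nonneg _), Plane.norm_sq_eq, Plane.norm_sq_eq]
  simp; ring

/-- The closed region `{(s, t) | 0 ≤ s, 0 ≤ t, s + t ≤ 1}`. -/
def Plane.stdTriangle : Set Plane := {x | 0 ≤ x 0 ∧ 0 ≤ x 1 ∧ x 0 + x 1 ≤ 1}

lemma Plane.measurePreserving_coords :
    MeasurePreserving (fun x : Plane => (x 0, x 1)) volume (volume : Measure (ℝ × ℝ)) :=
  (volume_preserving_finTwoArrow ℝ).comp (PiLp.volume_preserving_ofLp (Fin 2))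

lemma Plane.volume_setOf {S : Set (ℝ × ℝ)} (hS : MeasurableSet S) :
    volume {x : Plane | (x 0, x 1) ∈ S} = volume S :=
  Plane.measurePreserving_coords.measure_preimage hS.nullMeasurableSet

lemma Plane.volume_stdTriangle :
    volume.real Plane.stdTriangle = 1 / 2 := by
  have hc : IsClosed {p : ℝ × ℝ | 0 ≤ p.1 ∧ 0 ≤ p.2 ∧ p.1 + p.2 ≤ 1} := by
    simp only [Set.ofPred_and]
    exact (isClosed_le (by fun_prop) (by fun_prop)).inter
      ((isClosed_le (by fun_prop) (by fun_prop)).inter (isClosed_le (by fun_prop) (by fun_prop)))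
  have h1 : volume Plane.stdTriangle
      = volume {p : ℝ × ℝ | 0 ≤ p.1 ∧ 0 ≤ p.2 ∧ p.1 + p.2 ≤ 1} :=
    Plane.volume_setOf hc.measurableSet
  have h2 : volume {p : ℝ × ℝ | 0 ≤ p.1 ∧ 0 ≤ p.2 ∧ p.1 + p.2 ≤ 1} =
      ∫⁻ x in Set.Icc (0 : ℝ) 1, ENNReal.ofReal (1 - x) := by
    rw [Measure.volume_eq_prod, Measure.prod_apply hc.measurableSet,
      ← lintegral_indicator measurableSet_Icc]
    refine lintegral_congr fun x => ?_
    by_cases hx : x ∈ Set.Icc (0 : ℝ) 1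
    · rw [Set.indicator_of_mem hx]
      have : Prod.mk x ⁻¹' {p : ℝ × ℝ | 0 ≤ p.1 ∧ 0 ≤ p.2 ∧ p.1 + p.2 ≤ 1} = Set.Icc 0 (1 - x) := by
        ext y
        simp only [Set.mem_preimage, Set.mem_ofPred_eq, Set.mem_Icc]
        constructor
        · rintro ⟨_, h, h'⟩; exact ⟨h, by linarith⟩
        · rintro ⟨h, h'⟩; exact ⟨hx.1, h, by linarith⟩
      rw [this, Real.volume_Icc, sub_zero]
    · rw [Set.indicator_of_notMem hx]
      have : Prod.mk x ⁻¹' {p : ℝ × ℝ | 0 ≤ p.1 ∧ 0 ≤ p.2 ∧ p.1 + p.2 ≤ 1} = ∅ := by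
        ext y
        simp only [Set.mem_preimage, Set.mem_ofPred_eq, Set.mem_empty_iff_false, iff_false]
        rintro ⟨h, h', h''⟩; exact hx ⟨h, by linarith⟩
      rw [this, measure_empty]
  rw [Measure.real, h1, h2, ← ofReal_integral_eq_lintegral_ofReal]
  · rw [integral_Icc_eq_integral_Ioc, ← intervalIntegral.integral_of_le zero_le_one]
    rw [ENNReal.toReal_ofReal]
    · rw [intervalIntegral.integral_sub (by simp) (by simp)]; norm_num
    · exact intervalIntegral.integral_nonneg zero_le_one fun x hx => by linarith [hx.2]
  · exact Continuous.integrableOn_Icc (by fun_prop)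
  · exact (ae_restrict_iff' measurableSet_Icc).2 (.of_forall fun x hx => by
      simpa using hx.2)

/-- The determinant of two vectors of the plane. -/
def Plane.det (e f : Plane) : ℝ := e 0 * f 1 - e 1 * f 0

lemma Plane.det_eq_inner_rot (e f : Plane) : Plane.det e f = inner ℝ e.rot f := by
  rw [Plane.inner_eq, Plane.det]; simp; ring

/-- The linear map with columns `e` and `f`. -/
noncomputable def Plane.ofColumns (e f : Plane) : Plane →ₗ[ℝ] Plane :=
  Matrix.toEuclideanLin !![e 0, f 0; e 1, f 1]

lemma Plane.ofColumns_apply (e f x : Plane) : Plane.ofColumns e f x = x 0 • e + x 1 • f := by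
  ext i
  fin_cases i <;>
    simp [Plane.ofColumns, Matrix.toLpLin_apply, dotProduct, Fin.sum_univ_two, mul_comm]

lemma Plane.det_ofColumns (e f : Plane) : (Plane.ofColumns e f).det = Plane.det e f := by
  rw [Plane.ofColumns, LinearMap.det_toLpLin, Matrix.det_fin_two_of, Plane.det]; ring

lemma Plane.volume_image_affine (a e f : Plane) (S : Set Plane) :
    volume.real ((fun x : Plane => a + (x 0 • e + x 1 • f)) '' S)
      = |Plane.det e f| * volume.real S := by
  have : (fun x : Plane => a + (x 0 • e + x 1 • f)) '' S
      = (fun y => a + y) '' (Plane.ofColumns e f '' S) := by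
    rw [Set.image_image]
    simp_rw [Plane.ofColumns_apply]
  rw [this, Measure.real, Set.image_add_left, measure_preimage_add, Measure.addHaar_image_linearMap,
    Plane.det_ofColumns, ENNReal.toReal_mul, ENNReal.toReal_ofReal (abs_nonneg _), Measure.real]

lemma Plane.volume_triangle (a e f : Plane) :
    volume.real ((fun x : Plane => a + (x 0 • e + x 1 • f)) '' Plane.stdTriangle)
      = |Plane.det e f| / 2 := by
  rw [Plane.volume_image_affine, Plane.volume_stdTriangle]; ring

/-- The area of a set is at most the product of two orthogonal extents. -/
lemma Plane.volume_le_of_extents {S : Set Plane} {v : Plane} (hv : ‖v‖ = 1) {p q a b : ℝ}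
    (ha : 0 ≤ a) (hb : 0 ≤ b)
    (h1 : ∀ x ∈ S, inner ℝ v x ∈ Set.Icc p (p + a))
    (h2 : ∀ x ∈ S, inner ℝ v.rot x ∈ Set.Icc q (q + b)) :
    volume.real S ≤ a * b := by
  have hv2 : v 0 ^ 2 + v 1 ^ 2 = 1 := by rw [← Plane.norm_sq_eq, hv]; norm_num
  set R : Set (ℝ × ℝ) := Set.Icc p (p + a) ×ˢ Set.Icc q (q + b) with hR
  set B : Set Plane := {x : Plane | (x 0, x 1) ∈ R} with hB
  have hBv : volume B = ENNReal.ofReal a * ENNReal.ofReal b := by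
    rw [hB, Plane.volume_setOf (measurableSet_Icc.prod measurableSet_Icc), Measure.volume_eq_prod,
      Measure.prod_prod, Real.volume_Icc, Real.volume_Icc]
    congr 2 <;> ring
  have hBr : volume.real B = a * b := by
    rw [Measure.real, hBv, ENNReal.toReal_mul, ENNReal.toReal_ofReal ha, ENNReal.toReal_ofReal hb]
  have himg := Plane.volume_image_affine 0 v v.rot B
  have hdet : Plane.det v v.rot = 1 := by simp only [Plane.det, Plane.rot_apply_zero, Plane.rot_apply_one]; linarith
  rw [hdet, abs_one, one_mul, hBr] at himg
  rw [← himg]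
  refine measureReal_mono ?_ ?_
  · intro x hx
    refine ⟨!₂[inner ℝ v x, inner ℝ v.rot x], ⟨h1 x hx, h2 x hx⟩, ?_⟩
    ext i
    simp only [Plane.inner_eq]
    fin_cases i
    · simp; linear_combination x 0 * hv2
    · simp; linear_combination x 1 * hv2
  · intro h
    rw [Measure.real, h] at himg
    have hh : volume ((fun x : Plane => (0:Plane) + (x 0 • v + x 1 • v.rot)) '' B) ≠ ⊤ := by
      simp_rw [zero_add, ← Plane.ofColumns_apply]
      rw [Measure.addHaar_image_linearMap, hBv]
      finiteness
    exact hh h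

/-! ### Equilateral triangles through their unit normals -/

/-- Three unit vectors of the plane with sum zero: the outer normals of an equilateral triangle. -/
structure IsTripod (u : Fin 3 → Plane) : Prop where
  norm_eq_one : ∀ i, ‖u i‖ = 1
  sum_eq_zero : ∑ i, u i = 0

/-- The equilateral triangle of height `w` with centre `c` and outer normals `u i`. -/
def equiTriangle (c : Plane) (u : Fin 3 → Plane) (w : ℝ) : Set Plane :=
  {x | ∀ i, inner ℝ (u i) (x - c) ≤ w / 3}

lemma mem_equiTriangle {c : Plane} {u : Fin 3 → Plane} {w : ℝ} {x : Plane} :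
    x ∈ equiTriangle c u w ↔ ∀ i, inner ℝ (u i) (x - c) ≤ w / 3 := Iff.rfl

namespace IsTripod

variable {u : Fin 3 → Plane}

lemma sum_inner (hu : IsTripod u) (y : Plane) : ∑ i, inner ℝ (u i) y = 0 := by
  rw [← _root_.sum_inner, hu.sum_eq_zero, inner_zero_left]

lemma inner_self (hu : IsTripod u) (i : Fin 3) : inner ℝ (u i) (u i) = 1 := by
  rw [real_inner_self_eq_norm_sq, hu.norm_eq_one]; norm_num

lemma inner_of_ne (hu : IsTripod u) {i j : Fin 3} (h : i ≠ j) : inner ℝ (u i) (u j) = -1 / 2 := by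
  have h0 := hu.sum_inner (u 0)
  have h1 := hu.sum_inner (u 1)
  have h2 := hu.sum_inner (u 2)
  simp only [Fin.sum_univ_three, hu.inner_self] at h0 h1 h2
  have c01 := real_inner_comm (u 0) (u 1)
  have c02 := real_inner_comm (u 0) (u 2)
  have c12 := real_inner_comm (u 1) (u 2)
  fin_cases i <;> fin_cases j <;>
    first | exact absurd rfl h | (simp only [Fin.zero_eta, Fin.mk_one, Fin.reduceFinMk]; linarith)

/-- Both signs of `k = ±√3/2` occur: they are the two orientations of the tripod. -/
lemma exists_coord (hu : IsTripod u) : ∃ k : ℝ, k ^ 2 = 3 / 4 ∧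
    u 1 = (-1 / 2 : ℝ) • u 0 + k • (u 0).rot ∧ u 2 = (-1 / 2 : ℝ) • u 0 - k • (u 0).rot := by
  have h01 := hu.inner_of_ne (i := 0) (j := 1) (by decide)
  have h00 := hu.inner_self 0
  have h11 := hu.inner_self 1
  have hs := hu.sum_eq_zero
  rw [Fin.sum_univ_three] at hs
  rw [Plane.inner_eq] at h01 h00 h11
  set a := u 0 0 with ha
  set b := u 0 1 with hb
  set c := u 1 0 with hc
  set d := u 1 1 with hd
  have e1 : u 1 = (-1 / 2 : ℝ) • u 0 + (a * d - b * c) • (u 0).rot := by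
    ext i
    fin_cases i
    · simp [← ha, ← hb, ← hc]
      linear_combination (-c) * h00 + a * h01
    · simp [← ha, ← hb, ← hd]
      linear_combination (-d) * h00 + b * h01
  refine ⟨a * d - b * c, ?_, e1, ?_⟩
  · linear_combination (c * c + d * d) * h00 + h11 - (a * c + b * d - 1 / 2) * h01
  · have : u 2 = - u 0 - u 1 := by rw [← sub_eq_zero, ← hs]; abel
    rw [this, e1]
    module

/-- The tight frame identity. -/
lemma sum_inner_smul (hu : IsTripod u) (y : Plane) :
    ∑ i, inner ℝ (u i) y • u i = (3 / 2 : ℝ) • y := by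
  obtain ⟨k, hk, h1, h2⟩ := hu.exists_coord
  have h0 := hu.inner_self 0
  rw [Plane.inner_eq] at h0
  rw [Fin.sum_univ_three, h1, h2]
  simp only [Plane.inner_eq]
  ext i
  fin_cases i
  · simp
    linear_combination (3 / 2 * y 0) * h0 + 2 * (u 0 1 * (u 0 1 * y 0 - u 0 0 * y 1)) * hk
  · simp
    linear_combination (3 / 2 * y 1) * h0 + 2 * (u 0 0 * (u 0 0 * y 1 - u 0 1 * y 0)) * hk

lemma sum_inner_sq (hu : IsTripod u) (y : Plane) :
    ∑ i, inner ℝ (u i) y ^ 2 = 3 / 2 * ‖y‖ ^ 2 := by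
  have := congrArg (fun z => inner ℝ z y) (hu.sum_inner_smul y)
  simp only [_root_.sum_inner, real_inner_smul_left, real_inner_self_eq_norm_sq] at this
  rw [← this]
  exact Finset.sum_congr rfl fun i _ => sq _

/-- The constraints cut out a regular hexagon of inradius `w`, whose circumradius is `2w/√3`.
Applied to differences of points, this bounds the diameter of a triangle by its side. -/
lemma norm_le_of_abs_inner_le (hu : IsTripod u) {y : Plane} {w : ℝ}
    (h : ∀ i, |inner ℝ (u i) y| ≤ w) : ‖y‖ ≤ 2 * w / √3 := by
  have hw : 0 ≤ w := (abs_nonneg _).trans (h 0)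
  have h1 := hu.sum_inner_sq y
  have h2 := hu.sum_inner y
  rw [Fin.sum_univ_three] at h1 h2
  have b := fun i => abs_le.1 (h i)
  have b0 := b 0
  have b1 := b 1
  have b2 := b 2
  have key : ‖y‖ ^ 2 * 3 ≤ 4 * w ^ 2 := by
    generalize (inner ℝ (u 0) y : ℝ) = p at *
    generalize (inner ℝ (u 1) y : ℝ) = q at *
    generalize (inner ℝ (u 2) y : ℝ) = r at *
    have hr : r = -p - q := by linarith
    subst hr
    rcases le_total 0 p with hp | hp <;> rcases le_total 0 q with hq | hq <;>
      rcases le_total 0 (p + q) with hpq | hpq <;> nlinarith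
  rw [le_div_iff₀ (by positivity), ← sq_le_sq₀ (by positivity) (by positivity), mul_pow,
    Real.sq_sqrt (by norm_num)]
  linarith

/-- The circumradius of an equilateral triangle is twice its inradius. Algebraically, the pairwise
products of the slacks `t - ⟪u i, y⟫` sum to `3t² - (3/4)‖y‖²`. -/
lemma norm_le_of_inner_le (hu : IsTripod u) {y : Plane} {t : ℝ}
    (h : ∀ i, inner ℝ (u i) y ≤ t) : ‖y‖ ≤ 2 * t := by
  have h1 := hu.sum_inner_sq y
  have h2 := hu.sum_inner y
  rw [Fin.sum_univ_three] at h1 h2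
  have b0 := h 0
  have b1 := h 1
  have b2 := h 2
  have ht : 0 ≤ t := by linarith
  rw [← sq_le_sq₀ (by positivity) (by positivity)]
  generalize (inner ℝ (u 0) y : ℝ) = p at *
  generalize (inner ℝ (u 1) y : ℝ) = q at *
  generalize (inner ℝ (u 2) y : ℝ) = r at *
  have hr : r = -p - q := by linarith
  subst hr
  nlinarith [mul_nonneg (sub_nonneg.2 b0) (sub_nonneg.2 b1), mul_nonneg (sub_nonneg.2 b0) (sub_nonneg.2 b2),
    mul_nonneg (sub_nonneg.2 b1) (sub_nonneg.2 b2)]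

end IsTripod

/-- The vertices of `equiTriangle c u w`. -/
noncomputable def equiVertex (c : Plane) (u : Fin 3 → Plane) (w : ℝ) (i : Fin 3) : Plane :=
  c - (2 * w / 3) • u i

lemma exists_isTripod : ∃ u, IsTripod u := by
  have h3 : (√3 / 2) ^ 2 = 3 / 4 := by rw [div_pow, Real.sq_sqrt] <;> norm_num
  refine ⟨![!₂[1, 0], !₂[-1 / 2, √3 / 2], !₂[-1 / 2, -(√3 / 2)]], ?_, ?_⟩
  · intro i
    rw [← sq_eq_sq₀ (norm_nonneg _) zero_le_one, Plane.norm_sq_eq]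
    fin_cases i <;> simp [h3] <;> norm_num
  · rw [Fin.sum_univ_three]
    ext i
    fin_cases i <;> simp <;> norm_num

lemma isCompact_setOf_isTripod : IsCompact {u | IsTripod u} := by
  have : {u : Fin 3 → Plane | IsTripod u} =
      (Set.univ.pi fun _ : Fin 3 => Metric.sphere (0 : Plane) 1) ∩ {u | ∑ i, u i = 0} := by
    ext u
    constructor
    · exact fun h => ⟨fun i _ => by simpa using h.norm_eq_one i, h.sum_eq_zero⟩
    · exact fun h => ⟨fun i => by simpa using h.1 i trivial, h.2⟩
  rw [this]
  exact (isCompact_univ_pi fun _ => isCompact_sphere _ _).inter_right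
    (isClosed_eq (by fun_prop) (by fun_prop))

section

variable {c : Plane} {u : Fin 3 → Plane} {w : ℝ}

lemma isClosed_equiTriangle : IsClosed (equiTriangle c u w) := by
  have : equiTriangle c u w = ⋂ i, {x | inner ℝ (u i) (x - c) ≤ w / 3} := by
    ext x; simp [mem_equiTriangle]
  rw [this]
  exact isClosed_iInter fun i => isClosed_le (by fun_prop) (by fun_prop)

lemma inner_equiVertex_self (hu : IsTripod u) (i : Fin 3) :
    inner ℝ (u i) (equiVertex c u w i - c) = -(2 * w / 3) := by
  rw [equiVertex, sub_sub_cancel_left, inner_neg_right, real_inner_smul_right, hu.inner_self]; ring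

lemma inner_equiVertex_of_ne (hu : IsTripod u) {i j : Fin 3} (h : j ≠ i) :
    inner ℝ (u j) (equiVertex c u w i - c) = w / 3 := by
  rw [equiVertex, sub_sub_cancel_left, inner_neg_right, real_inner_smul_right, hu.inner_of_ne h]; ring

lemma norm_sub_le_of_mem_equiTriangle (hu : IsTripod u) {x : Plane} (hx : x ∈ equiTriangle c u w) :
    ‖x - c‖ ≤ 2 * w / 3 := by
  have := hu.norm_le_of_inner_le hx
  linarith

lemma isCompact_equiTriangle (hu : IsTripod u) : IsCompact (equiTriangle c u w) :=
  Metric.isCompact_of_isClosed_isBounded isClosed_equiTriangle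
    ((Metric.isBounded_closedBall (x := c) (r := 2 * w / 3)).subset fun x hx => by
      rw [mem_closedBall_iff_norm]; exact norm_sub_le_of_mem_equiTriangle hu hx)

lemma center_mem_equiTriangle (hw : 0 ≤ w) : c ∈ equiTriangle c u w := by
  intro i; simp; positivity

lemma convex_equiTriangle : Convex ℝ (equiTriangle c u w) := by
  have : equiTriangle c u w = ⋂ i, {x | inner ℝ (u i) x ≤ w / 3 + inner ℝ (u i) c} := by
    ext x; simp [mem_equiTriangle, inner_sub_right]
  rw [this]
  exact convex_iInter fun i => convex_halfSpace_le (innerₗ Plane (u i)).isLinear _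

lemma neg_le_inner_of_mem_equiTriangle (hu : IsTripod u) {x : Plane} (hx : x ∈ equiTriangle c u w)
    (i : Fin 3) : -(2 * w / 3) ≤ inner ℝ (u i) (x - c) := by
  have h2 := hu.sum_inner (x - c)
  rw [Fin.sum_univ_three] at h2
  have b0 := hx 0
  have b1 := hx 1
  have b2 := hx 2
  fin_cases i <;> simp only [Fin.zero_eta, Fin.mk_one, Fin.reduceFinMk] <;> linarith

lemma dist_le_of_mem_equiTriangle (hu : IsTripod u) {x y : Plane} (hx : x ∈ equiTriangle c u w)
    (hy : y ∈ equiTriangle c u w) : dist x y ≤ 2 * w / √3 := by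
  rw [dist_eq_norm]
  refine hu.norm_le_of_abs_inner_le fun i => ?_
  have h1 := neg_le_inner_of_mem_equiTriangle hu hx i
  have h2 := neg_le_inner_of_mem_equiTriangle hu hy i
  have h3 := hx i
  have h4 := hy i
  have : x - y = (x - c) - (y - c) := by abel
  rw [this, inner_sub_right, abs_le]
  constructor <;> linarith

lemma equiVertex_mem (hu : IsTripod u) (hw : 0 ≤ w) (i : Fin 3) :
    equiVertex c u w i ∈ equiTriangle c u w := by
  intro j
  rcases eq_or_ne j i with rfl | h
  · rw [inner_equiVertex_self hu]; linarith
  · rw [inner_equiVertex_of_ne hu h]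

/-- Barycentric description of an equilateral triangle. -/
lemma mem_equiTriangle_iff (hu : IsTripod u) (hw : 0 < w) {x : Plane} :
    x ∈ equiTriangle c u w ↔
      ∃ l : Fin 3 → ℝ, (∀ i, 0 ≤ l i) ∧ ∑ i, l i = 1 ∧ x = ∑ i, l i • equiVertex c u w i := by
  constructor
  · intro hx
    -- The barycentric coordinate is the distance to side `i` divided by the height.
    refine ⟨fun i => 1 / 3 - inner ℝ (u i) (x - c) / w, fun i => ?_, ?_, ?_⟩
    · have := hx i
      rw [sub_nonneg, div_le_iff₀ hw]; linarith
    · have : ∑ i, inner ℝ (u i) (x - c) / w = 0 := by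
        rw [← Finset.sum_div, hu.sum_inner, zero_div]
      rw [Finset.sum_sub_distrib, this]; simp
    · have h1 := hu.sum_inner (x - c)
      have h2 := hu.sum_inner_smul (x - c)
      have h3 := hu.sum_eq_zero
      have e : ∀ i, (1 / 3 - inner ℝ (u i) (x - c) / w) • equiVertex c u w i =
          (1 / 3 : ℝ) • c - (1 / w * inner ℝ (u i) (x - c)) • c - (2 * w / 9) • u i
            + (2 / 3 : ℝ) • (inner ℝ (u i) (x - c) • u i) := by
        intro i
        rw [equiVertex]
        match_scalars <;> field_simp <;> ring
      simp only [e]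
      rw [Finset.sum_add_distrib, Finset.sum_sub_distrib, Finset.sum_sub_distrib, ← Finset.smul_sum,
        ← Finset.smul_sum, ← Finset.smul_sum, ← Finset.sum_smul, ← Finset.mul_sum, h1, h2, h3]
      simp only [Finset.sum_const, Finset.card_univ, Fintype.card_fin]
      module
  · rintro ⟨l, hl, hs, rfl⟩
    exact convex_equiTriangle.sum_mem (fun i _ => hl i) hs fun i _ => equiVertex_mem hu hw.le i

lemma equiTriangle_eq_convexHull (hu : IsTripod u) (hw : 0 < w) :
    equiTriangle c u w = convexHull ℝ (Set.range (equiVertex c u w)) := by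
  refine Set.Subset.antisymm (fun x hx => ?_) (convexHull_min ?_ convex_equiTriangle)
  · obtain ⟨l, hl, hs, rfl⟩ := (mem_equiTriangle_iff hu hw).1 hx
    exact (convex_convexHull ℝ _).sum_mem (fun i _ => hl i) hs
      fun i _ => subset_convexHull ℝ _ (Set.mem_range_self i)
  · rintro _ ⟨i, rfl⟩; exact equiVertex_mem hu hw.le i

lemma volume_equiTriangle (hu : IsTripod u) (hw : 0 < w) :
    volume.real (equiTriangle c u w) = w ^ 2 / √3 := by
  have : equiTriangle c u w = (fun x : Plane => equiVertex c u w 0 +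
      (x 0 • (equiVertex c u w 1 - equiVertex c u w 0)
        + x 1 • (equiVertex c u w 2 - equiVertex c u w 0))) '' Plane.stdTriangle := by
    ext x
    rw [mem_equiTriangle_iff hu hw]
    constructor
    · rintro ⟨l, hl, hs, rfl⟩
      rw [Fin.sum_univ_three] at hs
      refine ⟨!₂[l 1, l 2], ⟨hl 1, hl 2, ?_⟩, ?_⟩
      · simp; linarith [hl 0]
      · have : l 0 = 1 - l 1 - l 2 := by linarith
        simp [Fin.sum_univ_three, this]; module
    · rintro ⟨y, ⟨h0, h1, h2⟩, rfl⟩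
      refine ⟨![1 - y 0 - y 1, y 0, y 1], fun i => ?_, ?_, ?_⟩
      · fin_cases i <;> simp <;> linarith
      · simp [Fin.sum_univ_three]; ring
      · simp [Fin.sum_univ_three]; module
  rw [this, Plane.volume_triangle]
  obtain ⟨k, hk, h1, h2⟩ := hu.exists_coord
  have h0 := hu.inner_self 0
  rw [Plane.inner_eq] at h0
  have hdet : Plane.det (equiVertex c u w 1 - equiVertex c u w 0)
      (equiVertex c u w 2 - equiVertex c u w 0) = 4 / 3 * w ^ 2 * k := by
    simp only [equiVertex, h1, h2, Plane.det]
    simp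
    linear_combination 4 / 3 * w ^ 2 * k * h0
  have hk' : |k| = √3 / 2 := by
    rw [← sq_eq_sq₀ (abs_nonneg _) (by positivity), sq_abs, hk, div_pow, Real.sq_sqrt] <;> norm_num
  rw [hdet, abs_mul, hk', abs_of_nonneg (by positivity)]
  field_simp
  rw [Real.sq_sqrt (by norm_num)]; ring

end

/-! ### Directional and minimal width -/

section Width

variable {K : Set Plane}

lemma sub_le_directionalWidth (hK : IsCompact K) {x y : Plane} (hx : x ∈ K) (hy : y ∈ K)
    (v : Plane) : inner ℝ v x - inner ℝ v y ≤ directionalWidth K v := by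
  have hc : IsCompact ((fun x => (inner ℝ v x : ℝ)) '' K) := hK.image (by fun_prop)
  exact sub_le_sub (le_csSup hc.bddAbove ⟨x, hx, rfl⟩) (csInf_le hc.bddBelow ⟨y, hy, rfl⟩)

lemma exists_directionalWidth_eq (hK : IsCompact K) (hne : K.Nonempty) (v : Plane) :
    ∃ x ∈ K, ∃ y ∈ K, directionalWidth K v = inner ℝ v x - inner ℝ v y ∧
      ∀ z ∈ K, inner ℝ v y ≤ inner ℝ v z ∧ inner ℝ v z ≤ inner ℝ v x := by
  have hc : IsCompact ((fun x => (inner ℝ v x : ℝ)) '' K) := hK.image (by fun_prop)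
  obtain ⟨x, hx, hx'⟩ := hc.sSup_mem (hne.image _)
  obtain ⟨y, hy, hy'⟩ := hc.sInf_mem (hne.image _)
  refine ⟨x, hx, y, hy, by rw [directionalWidth, ← hx', ← hy'], fun z hz => ⟨?_, ?_⟩⟩
  · exact hy'.le.trans (csInf_le hc.bddBelow ⟨z, hz, rfl⟩)
  · exact (le_csSup hc.bddAbove ⟨z, hz, rfl⟩).trans hx'.ge

lemma directionalWidth_nonneg (hK : IsCompact K) (hne : K.Nonempty) (v : Plane) :
    0 ≤ directionalWidth K v := by
  obtain ⟨x, hx⟩ := hne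
  simpa using sub_le_directionalWidth hK hx hx v

lemma minimalWidth_le (hK : IsCompact K) (hne : K.Nonempty) {v : Plane} (hv : ‖v‖ = 1) :
    minimalWidth K ≤ directionalWidth K v :=
  ciInf_le (f := fun u : Metric.sphere (0 : Plane) 1 => directionalWidth K u)
    ⟨0, by rintro _ ⟨u, rfl⟩; exact directionalWidth_nonneg hK hne u⟩ ⟨v, by simpa using hv⟩

instance : Nonempty (Metric.sphere (0 : Plane) 1) :=
  (NormedSpace.sphere_nonempty.2 zero_le_one).to_subtype

lemma le_minimalWidth {m : ℝ} (h : ∀ v : Plane, ‖v‖ = 1 → m ≤ directionalWidth K v) :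
    m ≤ minimalWidth K :=
  le_ciInf fun v => h v (by simp)

lemma exists_directionalWidth_lt {m : ℝ} (h : minimalWidth K < m) :
    ∃ v : Plane, ‖v‖ = 1 ∧ directionalWidth K v < m := by
  obtain ⟨v, hv⟩ := exists_lt_of_ciInf_lt h
  exact ⟨v, by simp, hv⟩

lemma minimalWidth_pos (hK : IsCompact K) (hi : (interior K).Nonempty) : 0 < minimalWidth K := by
  obtain ⟨x, hx⟩ := hi
  obtain ⟨r, hr, hb⟩ := Metric.isOpen_iff.1 isOpen_interior x hx
  refine lt_of_lt_of_le (half_pos hr) (le_minimalWidth fun v hv => ?_)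
  have hy : x + (r / 2) • v ∈ K := interior_subset (hb (by
    rw [Metric.mem_ball, dist_self_add_left, norm_smul, hv, Real.norm_of_nonneg (by positivity)]
    linarith))
  have := sub_le_directionalWidth hK hy (interior_subset hx) v
  rw [inner_add_right, real_inner_smul_right, real_inner_self_eq_norm_sq, hv] at this
  linarith

end Width

/-! ### Equilateral triangles of given width are the pairs `(c, u)` -/

section

variable {c : Plane} {u : Fin 3 → Plane} {w : ℝ}

lemma minimalWidth_equiTriangle (hu : IsTripod u) (hw : 0 < w) :
    minimalWidth (equiTriangle c u w) = w := by
  have hK : IsCompact (equiTriangle c u w) := isCompact_equiTriangle hu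
  have hne : (equiTriangle c u w).Nonempty := ⟨c, center_mem_equiTriangle hw.le⟩
  refine le_antisymm ((minimalWidth_le hK hne (hu.norm_eq_one 0)).trans ?_)
    (le_minimalWidth fun v hv => ?_)
  · obtain ⟨x, hx, y, hy, h, -⟩ := exists_directionalWidth_eq hK hne (u 0)
    have h1 := hx 0
    have h2 := neg_le_inner_of_mem_equiTriangle hu hy 0
    rw [inner_sub_right] at h1 h2
    linarith
  · have h1 := hu.sum_inner_sq v
    have h2 := hu.sum_inner v
    rw [hv, Fin.sum_univ_three] at h1
    rw [Fin.sum_univ_three] at h2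
    -- The vertices already give enough width. Three numbers with sum `0` and sum of squares `3/2`
    -- have two at distance at least `3/2`, with equality when `v = ± u i`.
    have key : ∀ i j, 2 * w / 3 * (inner ℝ (u i) v - inner ℝ (u j) v) ≤
        directionalWidth (equiTriangle c u w) v := by
      intro i j
      have := sub_le_directionalWidth hK (equiVertex_mem (c := c) hu hw.le j)
        (equiVertex_mem hu hw.le i) v
      simp only [equiVertex, inner_sub_right, real_inner_smul_right] at this
      rw [real_inner_comm v (u i), real_inner_comm v (u j)]
      linarith
    have k01 := key 0 1
    have k10 := key 1 0
    have k02 := key 0 2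
    have k20 := key 2 0
    have k12 := key 1 2
    have k21 := key 2 1
    generalize (inner ℝ (u 0) v : ℝ) = p at *
    generalize (inner ℝ (u 1) v : ℝ) = q at *
    generalize (inner ℝ (u 2) v : ℝ) = r at *
    generalize directionalWidth (equiTriangle c u w) v = d at *
    by_contra! hd
    have red : ∀ z, 2 * w / 3 * z ≤ d → z < 3 / 2 := by
      intro z hz
      by_contra! hz'
      nlinarith
    have m01 := red _ k01
    have m10 := red _ k10
    have m02 := red _ k02
    have m20 := red _ k20
    have m12 := red _ k12
    have m21 := red _ k21
    have hr : r = -p - q := by linarith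
    subst hr
    rcases le_total 0 p with hp | hp <;> rcases le_total 0 q with hq | hq <;>
      rcases le_total 0 (p + q) with hpq | hpq <;> nlinarith

lemma norm_sub_sq_of_isTripod (hu : IsTripod u) {i j : Fin 3} (h : i ≠ j) :
    ‖u i - u j‖ ^ 2 = 3 := by
  rw [norm_sub_sq_real, hu.inner_of_ne h, hu.norm_eq_one, hu.norm_eq_one]; norm_num

/-- Pairing an affine relation with `u e` isolates the coefficient at `e`, since the other two
vertices lie on a common level line of `u e`. -/
lemma affineIndependent_equiVertex (hu : IsTripod u) (hw : 0 < w) :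
    AffineIndependent ℝ (equiVertex c u w) := by
  rw [affineIndependent_iff]
  intro s l hl hs e he
  have h1 := congrArg (fun z => (inner ℝ (u e) z : ℝ)) hs
  simp only [inner_sum, real_inner_smul_right, inner_zero_right] at h1
  have h2 : ∀ i, l i * inner ℝ (u e) (equiVertex c u w i) =
      l i * (inner ℝ (u e) c + w / 3) - if i = e then w * l e else 0 := by
    intro i
    have : inner ℝ (u e) (equiVertex c u w i) =
        inner ℝ (u e) (equiVertex c u w i - c) + inner ℝ (u e) c := by rw [inner_sub_right]; ring
    rw [this]
    split_ifs with h
    · rw [h, inner_equiVertex_self hu]; ring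
    · rw [inner_equiVertex_of_ne hu (Ne.symm h)]; ring
  simp only [h2, Finset.sum_sub_distrib, ← Finset.sum_mul, hl, Finset.sum_ite_eq', he, if_true] at h1
  have : w * l e = 0 := by linarith
  exact (mul_eq_zero.1 this).resolve_left hw.ne'

lemma isEquilateralTriangle_equiTriangle (hu : IsTripod u) (hw : 0 < w) :
    IsEquilateralTriangle (equiTriangle c u w) := by
  refine ⟨⟨equiVertex c u w, affineIndependent_equiVertex hu hw⟩, ⟨2 * w / 3 * √3, fun i j hij => ?_⟩,
    equiTriangle_eq_convexHull hu hw⟩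
  have : ‖u j - u i‖ = √3 := by
    rw [← norm_sub_sq_of_isTripod hu hij.symm, Real.sqrt_sq (norm_nonneg _)]
  change dist (equiVertex c u w i) (equiVertex c u w j) = _
  rw [dist_eq_norm, equiVertex, equiVertex, sub_sub_sub_cancel_left, ← smul_sub, norm_smul, this,
    Real.norm_of_nonneg (by positivity)]

lemma IsEquilateralTriangle.exists_eq_equiTriangle {E : Set Plane} (hE : IsEquilateralTriangle E) :
    ∃ (c : Plane) (u : Fin 3 → Plane), IsTripod u ∧ 0 < minimalWidth E ∧
      E = equiTriangle c u (minimalWidth E) := by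
  obtain ⟨T, ⟨s, hs⟩, rfl⟩ := hE
  have hs0 : 0 < s := by
    rw [← hs 0 1 (by decide), dist_pos]
    exact T.independent.injective.ne (by decide)
  have h3 : (√3) ^ 2 = 3 := Real.sq_sqrt (by norm_num)
  have h3' : (0 : ℝ) < √3 := by positivity
  set p := T.points with hp
  set c : Plane := (1 / 3 : ℝ) • ∑ i, p i with hc
  -- The circumradius is `s / √3`, so this normalises the vector from a vertex to the centroid.
  set u : Fin 3 → Plane := fun i => (√3 / s) • (c - p i) with hu'
  have hu : IsTripod u := by
    have hn : ∀ i j k, i ≠ j → i ≠ k → j ≠ k → ‖(p j - p i) + (p k - p i)‖ ^ 2 = 3 * s ^ 2 := by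
      intro i j k hij hik hjk
      have e := norm_sub_sq_real (p j - p i) (p k - p i)
      rw [sub_sub_sub_cancel_right] at e
      rw [norm_add_sq_real]
      rw [← dist_eq_norm, ← dist_eq_norm, ← dist_eq_norm] at e
      rw [← dist_eq_norm, ← dist_eq_norm]
      rw [hs j i hij.symm, hs k i hik.symm] at *
      rw [hs j k hjk] at e
      linarith
    constructor
    · have aux : ∀ i j k, i ≠ j → i ≠ k → j ≠ k → c - p i = (1 / 3 : ℝ) • ((p j - p i) + (p k - p i)) →
          ‖u i‖ = 1 := by
        intro i j k hij hik hjk h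
        rw [← sq_eq_sq₀ (norm_nonneg _) zero_le_one, hu']
        simp only
        rw [h, norm_smul, norm_smul, mul_pow, mul_pow, hn i j k hij hik hjk,
          Real.norm_of_nonneg (by positivity), Real.norm_of_nonneg (by positivity), div_pow, h3]
        field_simp
      intro i
      fin_cases i
      · exact aux 0 1 2 (by decide) (by decide) (by decide)
          (by rw [hc, Fin.sum_univ_three]; module)
      · exact aux 1 0 2 (by decide) (by decide) (by decide)
          (by rw [hc, Fin.sum_univ_three]; module)
      · exact aux 2 0 1 (by decide) (by decide) (by decide)
          (by rw [hc, Fin.sum_univ_three]; module)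
    · have : c = (1 / 3 : ℝ) • (p 0 + p 1 + p 2) := by rw [hc, Fin.sum_univ_three]
      simp only [hu', Fin.sum_univ_three, this]; module
  have hw : 0 < √3 / 2 * s := by positivity
  have hv : equiVertex c u (√3 / 2 * s) = p := by
    funext i
    have : 2 * (√3 / 2 * s) / 3 * (√3 / s) = 1 := by field_simp; linarith
    rw [equiVertex, hu', smul_smul, this, one_smul, sub_sub_cancel]
  have hE : convexHull ℝ (Set.range p) = equiTriangle c u (√3 / 2 * s) := by
    rw [equiTriangle_eq_convexHull hu hw, hv]
  rw [hE, minimalWidth_equiTriangle hu hw]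
  exact ⟨c, u, hu, hw, rfl⟩

lemma exists_isEquilateralTriangle_iff (hw : 0 < w) {p : Set Plane → Prop} :
    (∃ E, IsEquilateralTriangle E ∧ minimalWidth E = w ∧ p E) ↔
      ∃ c u, IsTripod u ∧ p (equiTriangle c u w) := by
  constructor
  · rintro ⟨E, hE, rfl, h⟩
    obtain ⟨c, u, hu, -, h'⟩ := hE.exists_eq_equiTriangle
    exact ⟨c, u, hu, h' ▸ h⟩
  · rintro ⟨c, u, hu, h⟩
    exact ⟨_, isEquilateralTriangle_equiTriangle hu hw, minimalWidth_equiTriangle hu hw, h⟩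

end

lemma IsCompact.exists_dist_le_hausdorffDist {s t : Set Plane} (hs : IsCompact s) (ht : IsCompact t)
    (hne : t.Nonempty) {x : Plane} (hx : x ∈ s) : ∃ y ∈ t, dist x y ≤ Metric.hausdorffDist s t := by
  obtain ⟨y, hy, h⟩ := ht.exists_infDist_eq_dist hne x
  exact ⟨y, hy, h ▸ Metric.infDist_le_hausdorffDist_of_mem hx
    (Metric.hausdorffEDist_ne_top_of_nonempty_of_bounded ⟨x, hx⟩ hne hs.isBounded ht.isBounded)⟩

lemma dist_sum_smul_le {l : Fin 3 → ℝ} (hl : ∀ i, 0 ≤ l i) (hs : ∑ i, l i = 1)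
    {p q : Fin 3 → Plane} {r : ℝ} (h : ∀ i, dist (p i) (q i) ≤ r) :
    dist (∑ i, l i • p i) (∑ i, l i • q i) ≤ r := by
  rw [dist_eq_norm, ← Finset.sum_sub_distrib]
  calc ‖∑ i, (l i • p i - l i • q i)‖ ≤ ∑ i, l i * r := by
        refine norm_sum_le_of_le _ fun i _ => ?_
        rw [← smul_sub, norm_smul, Real.norm_of_nonneg (hl i), ← dist_eq_norm]
        exact mul_le_mul_of_nonneg_left (h i) (hl i)
    _ = r := by rw [← Finset.sum_mul, hs, one_mul]

/-! ### Existence of minimisers -/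

section Attainment

variable {w : ℝ}

/-- Match points with equal barycentric coordinates: they move no further than the vertices do. -/
lemma hausdorffDist_equiTriangle_le {c c' : Plane} {u u' : Fin 3 → Plane} (hu : IsTripod u)
    (hu' : IsTripod u') (hw : 0 < w) :
    Metric.hausdorffDist (equiTriangle c u w) (equiTriangle c' u' w) ≤
      ∑ i, dist (equiVertex c u w i) (equiVertex c' u' w i) := by
  have hle : ∀ i, dist (equiVertex c u w i) (equiVertex c' u' w i) ≤
      ∑ i, dist (equiVertex c u w i) (equiVertex c' u' w i) := fun i =>
    Finset.single_le_sum (f := fun i => dist (equiVertex c u w i) (equiVertex c' u' w i))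
      (fun i _ => dist_nonneg) (Finset.mem_univ i)
  refine Metric.hausdorffDist_le_of_mem_dist (Finset.sum_nonneg fun i _ => dist_nonneg) ?_ ?_
  · intro x hx
    obtain ⟨l, hl, hs, rfl⟩ := (mem_equiTriangle_iff hu hw).1 hx
    exact ⟨_, (mem_equiTriangle_iff hu' hw).2 ⟨l, hl, hs, rfl⟩, dist_sum_smul_le hl hs hle⟩
  · intro x hx
    obtain ⟨l, hl, hs, rfl⟩ := (mem_equiTriangle_iff hu' hw).1 hx
    exact ⟨_, (mem_equiTriangle_iff hu hw).2 ⟨l, hl, hs, rfl⟩,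
      dist_sum_smul_le hl hs fun i => (dist_comm _ _).trans_le (hle i)⟩

lemma continuousOn_hausdorffDist_equiTriangle {K : Set Plane} (hK : IsCompact K) (hne : K.Nonempty)
    (hw : 0 < w) :
    ContinuousOn (fun p : Plane × (Fin 3 → Plane) => Metric.hausdorffDist K (equiTriangle p.1 p.2 w))
      {p | IsTripod p.2} := by
  intro p hp
  rw [ContinuousWithinAt, tendsto_iff_dist_tendsto_zero]
  have hlim : Filter.Tendsto (fun q : Plane × (Fin 3 → Plane) =>
      ∑ i, dist (equiVertex q.1 q.2 w i) (equiVertex p.1 p.2 w i))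
      (nhdsWithin p {p | IsTripod p.2}) (nhds 0) := by
    have : Continuous (fun q : Plane × (Fin 3 → Plane) =>
        ∑ i, dist (equiVertex q.1 q.2 w i) (equiVertex p.1 p.2 w i)) := by
      unfold equiVertex; fun_prop
    simpa using (this.tendsto p).mono_left nhdsWithin_le_nhds
  refine squeeze_zero' (.of_forall fun _ => dist_nonneg) ?_ hlim
  filter_upwards [self_mem_nhdsWithin] with q hq
  have hfin : ∀ r : Plane × (Fin 3 → Plane), IsTripod r.2 →
      Metric.hausdorffEDist K (equiTriangle r.1 r.2 w) ≠ ⊤ := fun r hr =>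
    Metric.hausdorffEDist_ne_top_of_nonempty_of_bounded hne ⟨_, center_mem_equiTriangle hw.le⟩
      hK.isBounded (isCompact_equiTriangle hr).isBounded
  have h1 := Metric.hausdorffDist_triangle (u := equiTriangle p.1 p.2 w) (hfin q hq)
  have h2 := Metric.hausdorffDist_triangle (u := equiTriangle q.1 q.2 w) (hfin p hp)
  have h3 := hausdorffDist_equiTriangle_le (c := q.1) (c' := p.1) hq hp hw
  rw [Metric.hausdorffDist_comm (s := equiTriangle p.1 p.2 w)] at h2
  rw [Real.dist_eq, abs_le]
  constructor <;> linarith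

/-- The line is contained in the frontier of a half-plane, and frontiers of convex sets are null. -/
lemma volume_setOf_inner_eq {v : Plane} (hv : v ≠ 0) (a : ℝ) :
    volume {x : Plane | inner ℝ v x = a} = 0 := by
  have hc : Convex ℝ {x : Plane | inner ℝ v x ≤ a} :=
    convex_halfSpace_le (innerₗ Plane v).isLinear _
  refine measure_mono_null (fun x hx => ?_) (hc.addHaar_frontier volume)
  refine ⟨subset_closure (Set.mem_ofPred_eq ▸ hx.le), fun hi => ?_⟩
  obtain ⟨r, hr, hb⟩ := Metric.isOpen_iff.1 isOpen_interior x hi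
  have hn : 0 < ‖v‖ := norm_pos_iff.2 hv
  have : x + (r / 2 / ‖v‖) • v ∈ {x : Plane | inner ℝ v x ≤ a} := interior_subset (hb (by
    rw [Metric.mem_ball, dist_self_add_left, norm_smul, Real.norm_of_nonneg (by positivity),
      div_mul_cancel₀ _ hn.ne']
    linarith))
  have h2 : inner ℝ v x + r / 2 / ‖v‖ * inner ℝ v v ≤ a := by
    rw [← real_inner_smul_right, ← inner_add_right]; exact this
  have h3 : inner ℝ v x = a := hx
  have : 0 < r / 2 / ‖v‖ * inner ℝ v v := by
    rw [real_inner_self_eq_norm_sq]; positivity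
  linarith

/-- Off the three side lines of the limit triangle, a null set, membership is locally constant in
`(c, u)`. The indicators thus converge almost everywhere, with all sets near the limit inside one
compact set. -/
lemma continuousOn_volume_symmDiff_equiTriangle {K : Set Plane} (hK : IsCompact K) :
    ContinuousOn (fun p : Plane × (Fin 3 → Plane) => volume.real (K ∆ equiTriangle p.1 p.2 w))
      {p | IsTripod p.2} := by
  intro p hp
  have hmeas : ∀ q : Plane × (Fin 3 → Plane), MeasurableSet (K ∆ equiTriangle q.1 q.2 w) := fun q =>
    hK.measurableSet.symmDiff isClosed_equiTriangle.measurableSet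
  have hB : IsCompact (K ∪ Metric.closedBall p.1 (1 + 2 * w / 3)) := hK.union (isCompact_closedBall _ _)
  refine (ENNReal.tendsto_toReal ?_).comp
    (tendsto_measure_of_ae_tendsto_indicator _ (hmeas p) hmeas hB.measurableSet hB.measure_lt_top.ne
      ?_ ?_)
  · have hE := (isCompact_equiTriangle (c := p.1) (w := w) hp).measure_lt_top (μ := volume)
    exact ((measure_mono symmDiff_le_sup).trans_lt
      ((measure_union_le _ _).trans_lt (ENNReal.add_lt_top.2 ⟨hK.measure_lt_top, hE⟩))).ne
  · have hc : ∀ᶠ q : Plane × (Fin 3 → Plane) in nhdsWithin p {p | IsTripod p.2}, dist q.1 p.1 < 1 :=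
      nhdsWithin_le_nhds ((continuous_fst.tendsto p).eventually (Metric.ball_mem_nhds p.1 one_pos))
    filter_upwards [hc, self_mem_nhdsWithin] with q hq hq'
    refine symmDiff_le_sup.trans (Set.union_subset_union_right _ fun x hx => ?_)
    have := norm_sub_le_of_mem_equiTriangle hq' hx
    rw [← dist_eq_norm] at this
    rw [Metric.mem_closedBall]
    linarith [dist_triangle x q.1 p.1]
  · have hnull : ∀ i, ∀ᵐ x : Plane, inner ℝ (p.2 i) (x - p.1) ≠ w / 3 := by
      intro i
      have hne : p.2 i ≠ 0 := norm_ne_zero_iff.1 (by rw [hp.norm_eq_one i]; exact one_ne_zero)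
      refine measure_mono_null (fun x hx => ?_)
        (volume_setOf_inner_eq hne (w / 3 + inner ℝ (p.2 i) p.1))
      have : inner ℝ (p.2 i) (x - p.1) = w / 3 := by simpa using hx
      rw [inner_sub_right] at this
      change inner ℝ (p.2 i) x = _
      linarith
    filter_upwards [ae_all_iff.2 hnull] with x hx
    have hcont : ∀ i, Continuous fun q : Plane × (Fin 3 → Plane) =>
        (inner ℝ (q.2 i) (x - q.1) : ℝ) := fun i => by fun_prop
    have hev : ∀ i, ∀ᶠ q : Plane × (Fin 3 → Plane) in nhds p,
        (inner ℝ (q.2 i) (x - q.1) ≤ w / 3 ↔ inner ℝ (p.2 i) (x - p.1) ≤ w / 3) := by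
      intro i
      rcases lt_or_gt_of_ne (hx i) with h | h
      · filter_upwards [(hcont i).tendsto p |>.eventually (gt_mem_nhds h)] with q hq
        exact iff_of_true hq.le h.le
      · filter_upwards [(hcont i).tendsto p |>.eventually (lt_mem_nhds h)] with q hq
        exact iff_of_false hq.not_ge h.not_ge
    filter_upwards [nhdsWithin_le_nhds (Filter.eventually_all.2 hev)] with q hq
    have : x ∈ equiTriangle q.1 q.2 w ↔ x ∈ equiTriangle p.1 p.2 w := by
      simp only [mem_equiTriangle, hq]
    simp only [Set.mem_symmDiff, this]

/-- Only the centre can escape to infinity, so coercivity is needed in `p.1` alone. -/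
lemma exists_isTripod_forall_le {f : Plane × (Fin 3 → Plane) → ℝ}
    (hf : ContinuousOn f {p | IsTripod p.2}) {p₀ : Plane × (Fin 3 → Plane)} (hp₀ : IsTripod p₀.2)
    {R : ℝ} (hR : ∀ p, IsTripod p.2 → R < ‖p.1‖ → f p₀ ≤ f p) :
    ∃ p : Plane × (Fin 3 → Plane), IsTripod p.2 ∧ ∀ q : Plane × (Fin 3 → Plane), IsTripod q.2 → f p ≤ f q := by
  have hc : IsCompact (Metric.closedBall (0 : Plane) (max R ‖p₀.1‖) ×ˢ {u | IsTripod u}) :=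
    (isCompact_closedBall _ _).prod isCompact_setOf_isTripod
  have h₀ : p₀ ∈ Metric.closedBall (0 : Plane) (max R ‖p₀.1‖) ×ˢ {u | IsTripod u} :=
    ⟨by simp, hp₀⟩
  obtain ⟨p, hp, hmin⟩ := hc.exists_isMinOn ⟨p₀, h₀⟩ (hf.mono fun q hq => hq.2)
  refine ⟨p, hp.2, fun q hq => ?_⟩
  by_cases h : ‖q.1‖ ≤ max R ‖p₀.1‖
  · exact hmin (⟨by simpa using h, hq⟩ : q ∈ _ ×ˢ _)
  · exact (hmin h₀).trans (hR q hq ((le_max_left _ _).trans_lt (not_le.1 h)))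

lemma exists_minimizer_hausdorffDist {K : Set Plane} (hK : IsCompact K) (hne : K.Nonempty)
    (hw : 0 < w) : ∃ p : Plane × (Fin 3 → Plane), IsTripod p.2 ∧ ∀ q : Plane × (Fin 3 → Plane), IsTripod q.2 →
      Metric.hausdorffDist K (equiTriangle p.1 p.2 w) ≤
        Metric.hausdorffDist K (equiTriangle q.1 q.2 w) := by
  obtain ⟨u, hu⟩ := exists_isTripod
  obtain ⟨r, hr⟩ := hK.isBounded.subset_closedBall (0 : Plane)
  refine exists_isTripod_forall_le (continuousOn_hausdorffDist_equiTriangle hK hne hw)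
    (p₀ := (0, u)) hu (R := r + Metric.hausdorffDist K (equiTriangle 0 u w)) fun p hp h => ?_
  obtain ⟨y, hy, hd⟩ := (isCompact_equiTriangle (w := w) (c := p.1) hp).exists_dist_le_hausdorffDist
    hK hne (center_mem_equiTriangle hw.le)
  rw [Metric.hausdorffDist_comm] at hd
  have h1 : ‖y‖ ≤ r := by simpa using hr hy
  have h2 : ‖p.1‖ ≤ dist p.1 y + ‖y‖ := by
    rw [dist_eq_norm]; simpa using norm_add_le (p.1 - y) y
  linarith

lemma volume_symmDiff_le {A B : Set Plane} (hA : IsCompact A) (hB : IsCompact B) :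
    volume.real (A ∆ B) ≤ volume.real A + volume.real B :=
  (measureReal_mono symmDiff_le_sup (hA.union hB).measure_lt_top.ne).trans (measureReal_union_le _ _)

lemma exists_minimizer_volume_symmDiff {K : Set Plane} (hK : IsCompact K)
    (hw : 0 < w) : ∃ p : Plane × (Fin 3 → Plane), IsTripod p.2 ∧ ∀ q : Plane × (Fin 3 → Plane), IsTripod q.2 →
      volume.real (K ∆ equiTriangle p.1 p.2 w) ≤ volume.real (K ∆ equiTriangle q.1 q.2 w) := by
  obtain ⟨u, hu⟩ := exists_isTripod
  obtain ⟨r, hr⟩ := hK.isBounded.subset_closedBall (0 : Plane)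
  refine exists_isTripod_forall_le (continuousOn_volume_symmDiff_equiTriangle hK)
    (p₀ := (0, u)) hu (R := r + 2 * w / 3) fun p hp h => ?_
  -- A triangle far from `K` has the largest possible symmetric difference, `|K| + |E|`.
  have hdisj : Disjoint K (equiTriangle p.1 p.2 w) := by
    rw [Set.disjoint_left]
    intro x hx hx'
    have h1 : ‖x‖ ≤ r := by simpa using hr hx
    have h2 := norm_sub_le_of_mem_equiTriangle hp hx'
    have h3 : ‖p.1‖ ≤ ‖x - p.1‖ + ‖x‖ := by
      rw [norm_sub_rev]; simpa using norm_add_le (p.1 - x) x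
    linarith
  have h1 : K ∆ equiTriangle p.1 p.2 w = K ∪ equiTriangle p.1 p.2 w := hdisj.symmDiff_eq_sup
  simp only [h1]
  rw [measureReal_union hdisj isClosed_equiTriangle.measurableSet hK.measure_lt_top.ne
    (isCompact_equiTriangle hp).measure_lt_top.ne, volume_equiTriangle hp hw]
  refine (volume_symmDiff_le hK (isCompact_equiTriangle hu)).trans_eq ?_
  rw [volume_equiTriangle hu hw]

end Attainment

/-! ### Comparing Hausdorff distance and symmetric difference -/

section Comparison

variable {K : Set Plane} {c : Plane} {u : Fin 3 → Plane} {w : ℝ}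

/-- Enclose `K` in a rectangle with one side almost the minimal width and the other `D`; the `ε`
replaces a proof that the minimal width is attained. -/
lemma volume_le_minimalWidth_mul (hK : IsCompact K) (hne : K.Nonempty) {D : ℝ}
    (hD : ∀ x ∈ K, ∀ y ∈ K, dist x y ≤ D) : volume.real K ≤ minimalWidth K * D := by
  obtain ⟨x₀, hx₀⟩ := hne
  have hD0 : 0 ≤ D := dist_nonneg.trans (hD x₀ hx₀ x₀ hx₀)
  refine le_of_forall_pos_le_add fun ε hε => ?_
  obtain ⟨v, hv, hlt⟩ := exists_directionalWidth_lt
    (show minimalWidth K < minimalWidth K + ε / (D + 1) by linarith [show 0 < ε / (D + 1) by positivity])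
  obtain ⟨x, hx, y, hy, hxy, hb⟩ := exists_directionalWidth_eq hK ⟨x₀, hx₀⟩ v
  obtain ⟨x', hx', y', hy', hxy', hb'⟩ := exists_directionalWidth_eq hK ⟨x₀, hx₀⟩ v.rot
  have h0 := directionalWidth_nonneg hK ⟨x₀, hx₀⟩ v
  have hext : inner ℝ v.rot x' - inner ℝ v.rot y' ≤ D := by
    rw [← inner_sub_right]
    refine (real_inner_le_norm _ _).trans ?_
    rw [Plane.norm_rot, hv, one_mul, ← dist_eq_norm]
    exact hD x' hx' y' hy'
  have := Plane.volume_le_of_extents hv (p := inner ℝ v y) (q := inner ℝ v.rot y')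
    (a := minimalWidth K + ε / (D + 1)) (b := D) (h0.trans hlt.le) hD0
    (fun z hz => ⟨(hb z hz).1, by linarith [(hb z hz).2]⟩)
    (fun z hz => ⟨(hb' z hz).1, by linarith [(hb' z hz).2]⟩)
  refine this.trans ?_
  rw [add_mul]
  have : ε / (D + 1) * D ≤ ε := by
    rw [div_mul_eq_mul_div, div_le_iff₀ (by positivity)]; nlinarith
  linarith

/-- The width across the chord `ab` yields a point of `K` at distance at least half the minimal
width from its line; the triangle it spans with the chord lies in `K`. -/
lemma dist_mul_minimalWidth_le (hK : IsCompact K) (hc : Convex ℝ K) {a b : Plane} (ha : a ∈ K)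
    (hb : b ∈ K) : dist a b * minimalWidth K ≤ 4 * volume.real K := by
  rcases eq_or_ne a b with rfl | hab
  · simp
  have hn : 0 < dist a b := dist_pos.2 hab
  have key : ∃ p ∈ K, dist a b * minimalWidth K / 2 ≤ |Plane.det (b - a) (p - a)| := by
    set n := (b - a).rot with hn'
    have hnn : ‖n‖ = dist a b := by rw [hn', Plane.norm_rot, dist_comm, dist_eq_norm]
    have hu : ‖(dist a b)⁻¹ • n‖ = 1 := by
      rw [norm_smul, Real.norm_of_nonneg (by positivity), hnn, inv_mul_cancel₀ hn.ne']
    have hw := minimalWidth_le hK ⟨a, ha⟩ hu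
    obtain ⟨x, hx, y, hy, hxy, -⟩ := exists_directionalWidth_eq hK ⟨a, ha⟩ ((dist a b)⁻¹ • n)
    rw [hxy, ← inner_sub_right, real_inner_smul_left, ← sub_sub_sub_cancel_right x y a,
      inner_sub_right] at hw
    have hw' : dist a b * minimalWidth K ≤ inner ℝ n (x - a) - inner ℝ n (y - a) := by
      have := mul_le_mul_of_nonneg_left hw hn.le
      rwa [← mul_assoc, mul_inv_cancel₀ hn.ne', one_mul] at this
    simp only [Plane.det_eq_inner_rot, ← hn']
    rcases le_total (dist a b * minimalWidth K / 2) (inner ℝ n (x - a)) with h | h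
    · exact ⟨x, hx, h.trans (le_abs_self _)⟩
    · exact ⟨y, hy, le_trans (by linarith) (neg_le_abs _)⟩
  obtain ⟨p, hp, hle⟩ := key
  have hsub : (fun x : Plane => a + (x 0 • (b - a) + x 1 • (p - a))) '' Plane.stdTriangle ⊆ K := by
    rintro _ ⟨x, ⟨h0, h1, h2⟩, rfl⟩
    have := hc.sum_mem (t := Finset.univ) (w := ![1 - x 0 - x 1, x 0, x 1]) (z := ![a, b, p])
      (by intro i _; fin_cases i <;> simp <;> linarith)
      (by simp [Fin.sum_univ_three]; ring)
      (by intro i _; fin_cases i <;> simp [ha, hb, hp])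
    convert this using 1
    simp [Fin.sum_univ_three]; module
  have := measureReal_mono (μ := volume) hsub hK.measure_lt_top.ne
  rw [Plane.volume_triangle] at this
  linarith

lemma equiTriangle_mono {w' : ℝ} (h : w ≤ w') : equiTriangle c u w ⊆ equiTriangle c u w' :=
  fun x hx i => (hx i).trans (by linarith)

lemma subset_equiTriangle_of_hausdorffDist (hK : IsCompact K) (hu : IsTripod u) (hw : 0 < w) :
    K ⊆ equiTriangle c u (w + 3 * Metric.hausdorffDist K (equiTriangle c u w)) := by
  intro x hx i
  obtain ⟨y, hy, hd⟩ := hK.exists_dist_le_hausdorffDist (isCompact_equiTriangle (c := c) (w := w) hu)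
    ⟨c, center_mem_equiTriangle hw.le⟩ hx
  have h1 := hy i
  have h2 := real_inner_le_norm (u i) (x - y)
  rw [hu.norm_eq_one, one_mul, ← dist_eq_norm] at h2
  have : x - c = (x - y) + (y - c) := by abel
  rw [this, inner_add_right]
  linarith

/-- Otherwise separate `x` from `K` and push it by `d` along the separating normal: it stays in the
triangle of height `w` but is more than `d` away from `K`. -/
lemma equiTriangle_subset_of_hausdorffDist (hK : IsCompact K) (hc : Convex ℝ K) (hne : K.Nonempty)
    (hu : IsTripod u) :
    equiTriangle c u (w - 3 * Metric.hausdorffDist K (equiTriangle c u w)) ⊆ K := by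
  intro x hx
  by_contra hxK
  obtain ⟨f, s, hf, hs⟩ := geometric_hahn_banach_closed_point hc hK.isClosed hxK
  set d := Metric.hausdorffDist K (equiTriangle c u w) with hd
  set v := (InnerProductSpace.toDual ℝ Plane).symm f with hv
  have hvf : ∀ z, inner ℝ v z = f z := fun z => InnerProductSpace.toDual_symm_apply
  have hv0 : v ≠ 0 := by
    intro h
    obtain ⟨y, hy⟩ := hne
    have h1 := hf y hy
    rw [← hvf, h, inner_zero_left] at h1 hs
    linarith
  have hn : 0 < ‖v‖ := norm_pos_iff.2 hv0
  have hd0 : 0 ≤ d := Metric.hausdorffDist_nonneg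
  have hz : x + (d / ‖v‖) • v ∈ equiTriangle c u w := by
    intro i
    have h1 := hx i
    have h2 : inner ℝ (u i) ((d / ‖v‖) • v) ≤ d := by
      refine (real_inner_le_norm _ _).trans ?_
      rw [hu.norm_eq_one, one_mul, norm_smul, Real.norm_of_nonneg (by positivity),
        div_mul_cancel₀ _ hn.ne']
    rw [add_sub_right_comm, inner_add_right]
    linarith
  obtain ⟨y, hy, hy'⟩ := (isCompact_equiTriangle hu).exists_dist_le_hausdorffDist hK hne hz
  rw [Metric.hausdorffDist_comm, ← hd] at hy'
  have h1 := hf y hy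
  rw [← hvf] at h1 hs
  have h2 := real_inner_le_norm v (x + (d / ‖v‖) • v - y)
  rw [← dist_eq_norm, inner_sub_right, inner_add_right, real_inner_smul_right,
    real_inner_self_eq_norm_sq] at h2
  have h3 : d / ‖v‖ * ‖v‖ ^ 2 = ‖v‖ * d := by field_simp
  have h4 := mul_le_mul_of_nonneg_left hy' hn.le
  linarith

/-- The area of the symmetric difference is controlled by the Hausdorff distance. -/
lemma volume_symmDiff_le_hausdorffDist (hK : IsCompact K) (hc : Convex ℝ K) (hne : K.Nonempty)
    (hw : 0 < minimalWidth K) (hu : IsTripod u) :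
    volume.real (K ∆ equiTriangle c u (minimalWidth K)) ≤ (3 * √3 + 2) *
      (minimalWidth K * Metric.hausdorffDist K (equiTriangle c u (minimalWidth K))) := by
  set w := minimalWidth K with hw'
  set d := Metric.hausdorffDist K (equiTriangle c u w) with hd
  have hd0 : 0 ≤ d := Metric.hausdorffDist_nonneg
  have hE : IsCompact (equiTriangle c u w) := isCompact_equiTriangle hu
  have h3 : √3 ^ 2 = 3 := Real.sq_sqrt (by norm_num)
  have h3' : (0 : ℝ) < √3 := by positivity
  have hinv : 1 / √3 = √3 / 3 := by rw [div_eq_div_iff h3'.ne' (by norm_num)]; linarith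
  -- In the first case `|K| + |E| ≤ √3 w² + 2wd`, and one factor `w` is replaced by `3d`.
  rcases le_or_gt w (3 * d) with h | h
  · have hdist : ∀ x ∈ K, ∀ y ∈ K, dist x y ≤ 2 * w / √3 + 2 * d := by
      intro x hx y hy
      obtain ⟨x', hx', hdx⟩ := hK.exists_dist_le_hausdorffDist hE ⟨c, center_mem_equiTriangle hw.le⟩ hx
      obtain ⟨y', hy', hdy⟩ := hK.exists_dist_le_hausdorffDist hE ⟨c, center_mem_equiTriangle hw.le⟩ hy
      have h1 := dist_le_of_mem_equiTriangle hu hx' hy'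
      have h2 := dist_triangle4 x x' y' y
      rw [dist_comm y' y] at h2
      linarith
    have h1 := volume_le_minimalWidth_mul hK hne hdist
    have h2 := volume_symmDiff_le hK hE
    rw [volume_equiTriangle hu hw] at h2
    have e1 : 2 * w / √3 = 2 * w * (√3 / 3) := by rw [← hinv]; ring
    have e2 : w ^ 2 / √3 = w ^ 2 * (√3 / 3) := by rw [← hinv]; ring
    rw [← hw', e1] at h1
    rw [e2] at h2
    have h5 := mul_le_mul_of_nonneg_left h (show 0 ≤ √3 * w by positivity)
    nlinarith
  · have hsub : K ∆ equiTriangle c u w ⊆ equiTriangle c u (w + 3 * d) \ equiTriangle c u (w - 3 * d) := by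
      have s1 := subset_equiTriangle_of_hausdorffDist (c := c) hK hu hw
      have s2 := equiTriangle_subset_of_hausdorffDist (c := c) (w := w) hK hc hne hu
      rintro x (⟨hx, hx'⟩ | ⟨hx, hx'⟩)
      · exact ⟨s1 hx, fun hx'' => hx' (equiTriangle_mono (by linarith) hx'')⟩
      · exact ⟨equiTriangle_mono (by linarith) hx, fun hx'' => hx' (s2 hx'')⟩
    have hbig := (isCompact_equiTriangle (c := c) (w := w + 3 * d) hu).measure_lt_top (μ := volume)
    have h1 := measureReal_mono (μ := volume) hsub ((measure_mono Set.sdiff_subset).trans_lt hbig).ne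
    rw [measureReal_sdiff (equiTriangle_mono (by linarith)) isClosed_equiTriangle.measurableSet hbig.ne,
      volume_equiTriangle hu (by linarith), volume_equiTriangle hu (by linarith)] at h1
    have e : (w + 3 * d) ^ 2 / √3 - (w - 3 * d) ^ 2 / √3 = 4 * √3 * (w * d) := by
      field_simp; rw [h3]; ring
    rw [e] at h1
    have h2 : √3 ≤ 2 := by rw [Real.sqrt_le_left (by norm_num)]; norm_num
    have h4 : 0 ≤ w * d := by positivity
    nlinarith

/-- If a convex body reaches beyond a side of a triangle, then a strip along that side inside the
triangle has small area. -/
lemma volume_strip_le (hK : IsCompact K) (hc : Convex ℝ K) (hu : IsTripod u)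
    {i : Fin 3} {x : Plane} (hx : x ∈ K) {t : ℝ} (ht : w / 3 + t ≤ inner ℝ (u i) (x - c)) (ht0 : 0 ≤ t) :
    volume.real (equiTriangle c u w ∩ {z | w / 3 - t / 3 < inner ℝ (u i) (z - c)}) ≤
      volume.real (K ∆ equiTriangle c u w) := by
  set E := equiTriangle c u w with hE'
  have hE : IsCompact E := isCompact_equiTriangle hu
  set A := K ∩ {z | w / 3 - t / 3 < inner ℝ (u i) (z - c)} with hA
  set B := K ∩ {z | w / 3 < inner ℝ (u i) (z - c)} with hB
  have hBm : MeasurableSet B := hK.measurableSet.inter (measurableSet_lt (by fun_prop) (by fun_prop))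
  have fin : ∀ {S : Set Plane}, S ⊆ K → volume S ≠ ⊤ := fun h =>
    ((measure_mono h).trans_lt hK.measure_lt_top).ne
  have finE : ∀ {S : Set Plane}, S ⊆ E → volume S ≠ ⊤ := fun h =>
    ((measure_mono h).trans_lt hE.measure_lt_top).ne
  -- Contracting towards `x` by `3/4` sends the level `w/3 - t/3` to at least `w/3`, beyond the
  -- side. Since `(3/4)² ≥ 1/2`, the part `A \ B` is no larger than `B`, which lies outside `E`.
  have himg : AffineMap.homothety x (3 / 4 : ℝ) '' A ⊆ B := by
    rintro _ ⟨z, ⟨hz, hz'⟩, rfl⟩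
    have hz'' : w / 3 - t / 3 < inner ℝ (u i) (z - c) := hz'
    rw [AffineMap.homothety_apply]
    constructor
    · have := hc hz hx (show (0 : ℝ) ≤ 3 / 4 by norm_num) (show (0 : ℝ) ≤ 1 / 4 by norm_num) (by norm_num)
      convert this using 1
      simp only [vsub_eq_sub, vadd_eq_add]; module
    · change w / 3 < inner ℝ (u i) ((3 / 4 : ℝ) • (z - x) + x - c)
      have : (3 / 4 : ℝ) • (z - x) + x - c = (3 / 4 : ℝ) • (z - c) + (1 / 4 : ℝ) • (x - c) := by module
      rw [this, inner_add_right, real_inner_smul_right, real_inner_smul_right]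
      linarith
  have h1 : 9 / 16 * volume.real A ≤ volume.real B := by
    have := measureReal_mono (μ := volume) himg (fin Set.inter_subset_left)
    rw [Measure.real, Measure.addHaar_image_homothety, ENNReal.toReal_mul,
      ENNReal.toReal_ofReal (abs_nonneg _)] at this
    norm_num at this
    exact this
  have hBA : B ⊆ A := fun z hz => ⟨hz.1, by
    have : w / 3 < inner ℝ (u i) (z - c) := hz.2
    change w / 3 - t / 3 < inner ℝ (u i) (z - c)
    linarith⟩
  have h2 := measureReal_sdiff (μ := volume) hBA hBm (fin Set.inter_subset_left)
  have h3 : volume.real B ≤ volume.real (K \ E) :=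
    measureReal_mono (fun z hz => ⟨hz.1, fun h => not_le.2 hz.2 (h i)⟩) (fin Set.sdiff_subset)
  have h4 : volume.real (E ∩ {z | w / 3 - t / 3 < inner ℝ (u i) (z - c)}) ≤
      volume.real (A \ B) + volume.real (E \ K) := by
    refine (measureReal_mono ?_ ?_).trans (measureReal_union_le _ _)
    · rintro z ⟨hz, hz'⟩
      by_cases hzK : z ∈ K
      · exact Or.inl ⟨⟨hzK, hz'⟩, fun h => not_le.2 h.2 (hz i)⟩
      · exact Or.inr ⟨hz, hzK⟩
    · exact ((measure_union_le _ _).trans_lt (ENNReal.add_lt_top.2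
        ⟨(fin (Set.sdiff_subset.trans Set.inter_subset_left)).lt_top, (finE Set.sdiff_subset).lt_top⟩)).ne
  have h5 := measureReal_symmDiff_eq (μ := volume) hK.measurableSet hE.measurableSet
    hK.measure_lt_top.ne hE.measure_lt_top.ne
  have h6 : (0 : ℝ) ≤ volume.real B := measureReal_nonneg
  linarith

/-- Cutting off a strip along side `i` leaves a triangle with the same vertex opposite that side,
hence the shift of the centre. -/
lemma equiTriangle_inter_subset (hu : IsTripod u) (i : Fin 3) (h : ℝ) :
    equiTriangle c u w ∩ {z | inner ℝ (u i) (z - c) ≤ w / 3 - h} ⊆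
      equiTriangle (c - (2 / 3 * h) • u i) u (w - h) := by
  rintro z ⟨hz, hz'⟩ j
  have hz'' : inner ℝ (u i) (z - c) ≤ w / 3 - h := hz'
  rw [← sub_add, inner_add_right, real_inner_smul_right]
  rcases eq_or_ne j i with rfl | hj
  · rw [hu.inner_self]; linarith
  · rw [hu.inner_of_ne hj]; linarith [hz j]

lemma subset_equiTriangle_of_volume_symmDiff_lt (hK : IsCompact K) (hc : Convex ℝ K) (hu : IsTripod u)
    (hw : 0 < w) (h : volume.real (K ∆ equiTriangle c u w) < w ^ 2 / √3) :
    K ⊆ equiTriangle c u (w + 3 * (3 * √3 * volume.real (K ∆ equiTriangle c u w) / w)) := by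
  intro x hx i
  have h3' : (0 : ℝ) < √3 := by positivity
  have hS0 : 0 ≤ volume.real (K ∆ equiTriangle c u w) := measureReal_nonneg
  by_contra! hlt
  set S := volume.real (K ∆ equiTriangle c u w) with hS
  set T := 3 * √3 * S / w with hT
  have hT0 : 0 ≤ T := by positivity
  have hTw : T < 3 * w := by
    rw [hT, div_lt_iff₀ hw]
    rw [lt_div_iff₀ h3'] at h
    nlinarith
  -- Keeping `t < 3w` leaves a triangle of positive height `w - t/3` after removing the strip, and
  -- makes the strip area at least `wt / (3√3)`, which exceeds `S` once `t > T`.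
  obtain ⟨t, hTt, htm⟩ := exists_between
    (show T < min (inner ℝ (u i) (x - c) - w / 3) (3 * w) from lt_min (by linarith) hTw)
  obtain ⟨ht1, ht2⟩ := lt_min_iff.1 htm
  have hst := volume_strip_le hK hc hu hx (show w / 3 + t ≤ inner ℝ (u i) (x - c) by linarith)
    (by linarith)
  have hE := (isCompact_equiTriangle (c := c) (w := w) hu).measure_lt_top (μ := volume)
  have hE' := (isCompact_equiTriangle (c := c - (2 / 3 * (t / 3)) • u i) (w := w - t / 3) hu).measure_lt_top
    (μ := volume)
  have h4 : volume.real (equiTriangle c u w) ≤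
      volume.real (equiTriangle c u w ∩ {z | w / 3 - t / 3 < inner ℝ (u i) (z - c)}) +
      volume.real (equiTriangle (c - (2 / 3 * (t / 3)) • u i) u (w - t / 3)) := by
    refine (measureReal_mono ?_ ?_).trans (measureReal_union_le _ _)
    · intro z hz
      rcases lt_or_ge (w / 3 - t / 3) (inner ℝ (u i) (z - c)) with h | h
      · exact Or.inl ⟨hz, h⟩
      · exact Or.inr (equiTriangle_inter_subset hu i _ ⟨hz, h⟩)
    · exact ((measure_union_le _ _).trans_lt (ENNReal.add_lt_top.2
        ⟨(measure_mono Set.inter_subset_left).trans_lt hE, hE'⟩)).ne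
  rw [volume_equiTriangle hu hw, volume_equiTriangle hu (by linarith)] at h4
  have h5 : w ^ 2 ≤ √3 * S + (w - t / 3) ^ 2 := by
    have := mul_le_mul_of_nonneg_left (h4.trans (add_le_add_left hst _)) h3'.le
    rw [mul_add, mul_div_cancel₀ _ h3'.ne', mul_div_cancel₀ _ h3'.ne'] at this
    exact this
  have h6 : T * w = 3 * √3 * S := by rw [hT, div_mul_cancel₀ _ hw.ne']
  nlinarith

lemma hausdorffDist_le_of_subset (hK : IsCompact K) (hc : Convex ℝ K) (hne : K.Nonempty)
    (hu : IsTripod u) (hw : 0 < minimalWidth K) {T : ℝ} (hT : 0 ≤ T)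
    (hsub : K ⊆ equiTriangle c u (minimalWidth K + 3 * T)) :
    Metric.hausdorffDist K (equiTriangle c u (minimalWidth K)) ≤ 2 * T := by
  set w := minimalWidth K with hw'
  refine Metric.hausdorffDist_le_of_mem_dist (by positivity) (fun x hx => ?_) fun y hy => ?_
  · have hr0 : 0 < w + 3 * T := by positivity
    -- Shrinking the large triangle onto the small one moves points by at most the difference `2T`
    -- of the circumradii.
    refine ⟨c + (w / (w + 3 * T)) • (x - c), fun i => ?_, ?_⟩
    · rw [add_sub_cancel_left, real_inner_smul_right, div_mul_eq_mul_div, div_le_iff₀ hr0]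
      nlinarith [hsub hx i]
    · have : x - (c + (w / (w + 3 * T)) • (x - c)) = (3 * T / (w + 3 * T)) • (x - c) := by
        have e : 3 * T / (w + 3 * T) = 1 - w / (w + 3 * T) := by field_simp; ring
        rw [e]; module
      rw [dist_eq_norm, this, norm_smul, Real.norm_of_nonneg (by positivity), div_mul_eq_mul_div,
        div_le_iff₀ hr0]
      nlinarith [norm_sub_le_of_mem_equiTriangle hu (hsub hx)]
  -- The lowest point `z` of `K` in direction `u i` is at least `w` below a point of level at most
  -- `w/3 + T`. Its offset from vertex `i` therefore has all three normal components at most `T`,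
  -- hence norm at most `2T`.
  · have hz : ∀ i, ∃ z ∈ K, dist (equiVertex c u w i) z ≤ 2 * T := by
      intro i
      obtain ⟨x, hx, z, hz, hxz, -⟩ := exists_directionalWidth_eq hK hne (u i)
      have h1 := minimalWidth_le hK hne (hu.norm_eq_one i)
      refine ⟨z, hz, ?_⟩
      rw [dist_comm, dist_eq_norm]
      refine hu.norm_le_of_inner_le fun j => ?_
      have h2 := hsub hx i
      have h3 := hsub hz j
      have e : z - equiVertex c u w i = (z - c) - (equiVertex c u w i - c) := by abel
      rw [e, inner_sub_right]
      rcases eq_or_ne j i with rfl | hj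
      · rw [inner_equiVertex_self hu]
        rw [inner_sub_right] at h2 ⊢
        linarith
      · rw [inner_equiVertex_of_ne hu hj]
        linarith
    choose z hzK hz using hz
    obtain ⟨l, hl, hs, rfl⟩ := (mem_equiTriangle_iff hu hw).1 hy
    exact ⟨_, hc.sum_mem (fun i _ => hl i) hs fun i _ => hzK i, dist_sum_smul_le hl hs hz⟩

/-- A suitable equilateral triangle has Hausdorff distance controlled by the area of the symmetric
difference with a given one. -/
lemma exists_hausdorffDist_le_volume_symmDiff (hK : IsCompact K) (hc : Convex ℝ K) (hne : K.Nonempty)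
    (hu : IsTripod u) (hw : 0 < minimalWidth K) (c : Plane) :
    ∃ c', minimalWidth K * Metric.hausdorffDist K (equiTriangle c' u (minimalWidth K)) ≤
      25 * √5 * volume.real (K ∆ equiTriangle c u (minimalWidth K)) := by
  set w := minimalWidth K with hw'
  set S := volume.real (K ∆ equiTriangle c u w) with hS
  have hS0 : 0 ≤ S := measureReal_nonneg
  have h3 : √3 ≤ 2 := by rw [Real.sqrt_le_left (by norm_num)]; norm_num
  have h3' : (0 : ℝ) < √3 := by positivity
  have h5 : 1 ≤ √5 := by rw [Real.one_le_sqrt]; norm_num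
  -- The threshold is the area of the triangle. Above it the given triangle may be far from `K`, so
  -- its centre is moved into `K`.
  rcases lt_or_ge S (w ^ 2 / √3) with h | h
  · refine ⟨c, ?_⟩
    have := hausdorffDist_le_of_subset hK hc hne hu hw (by positivity)
      (subset_equiTriangle_of_volume_symmDiff_lt hK hc hu hw h)
    have h1 := mul_le_mul_of_nonneg_left this hw.le
    have e : w * (2 * (3 * √3 * S / w)) = 6 * √3 * S := by field_simp; ring
    rw [← hw', ← hS, e] at h1
    refine h1.trans (mul_le_mul_of_nonneg_right ?_ hS0)
    linarith
  · obtain ⟨k, hk⟩ := hne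
    have hE := isCompact_equiTriangle (c := c) (w := w) hu
    have hKS : volume.real K ≤ 2 * S := by
      have : volume.real K ≤ S + volume.real (equiTriangle c u w) := by
        refine (measureReal_mono (fun x hx => ?_) ?_).trans (measureReal_union_le _ _)
        · by_cases hx' : x ∈ equiTriangle c u w
          · exact Or.inr hx'
          · exact Or.inl (Or.inl ⟨hx, hx'⟩)
        · exact ((measure_mono (Set.union_subset_union_left _ symmDiff_le_sup)).trans_lt
            ((hK.union hE).union hE).measure_lt_top).ne
      rw [volume_equiTriangle hu hw] at this
      linarith
    have hwS : w ^ 2 ≤ 2 * S := by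
      rw [div_le_iff₀ h3'] at h
      nlinarith
    have hd : Metric.hausdorffDist K (equiTriangle k u w) ≤ 8 * S / w := by
      refine Metric.hausdorffDist_le_of_mem_dist (by positivity)
        (fun x hx => ⟨k, center_mem_equiTriangle hw.le, ?_⟩) (fun y hy => ⟨k, hk, ?_⟩)
      · rw [le_div_iff₀ hw]
        linarith [dist_mul_minimalWidth_le hK hc hx hk]
      · rw [le_div_iff₀ hw, dist_eq_norm]
        nlinarith [norm_sub_le_of_mem_equiTriangle hu hy]
    refine ⟨k, (mul_le_mul_of_nonneg_left hd hw.le).trans ?_⟩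
    rw [mul_div_cancel₀ _ hw.ne']
    nlinarith

end Comparison

/-! ### Conclusion for the two asymmetries -/

lemma mem_hausdorffRatios_iff {K : Set Plane} (hw : 0 < minimalWidth K) {t : ℝ} :
    t ∈ hausdorffRatios K ↔ ∃ c u, IsTripod u ∧
      t = Metric.hausdorffDist K (equiTriangle c u (minimalWidth K)) / minimalWidth K := by
  rw [← exists_isEquilateralTriangle_iff hw
    (p := fun E => t = Metric.hausdorffDist K E / minimalWidth K)]
  exact exists_congr fun E => and_congr_right fun _ => and_congr_right fun h => by rw [h]

lemma mem_fraenkelRatios_iff {K : Set Plane} (hw : 0 < minimalWidth K) {t : ℝ} :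
    t ∈ fraenkelRatios K ↔ ∃ c u, IsTripod u ∧
      t = volume.real (K ∆ equiTriangle c u (minimalWidth K)) / minimalWidth K ^ 2 := by
  rw [← exists_isEquilateralTriangle_iff hw
    (p := fun E => t = volume.real (K ∆ E) / minimalWidth K ^ 2)]
  exact exists_congr fun E => and_congr_right fun _ => and_congr_right fun h => by rw [h]

theorem mainTheorem5 (K : ConvexBody Plane) (hK : (interior (K : Set Plane)).Nonempty) :
    IsLeast (hausdorffRatios K) (hausdorffAsymmetry K) ∧
    IsLeast (fraenkelRatios K) (fraenkelAsymmetry K) ∧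
    1 / (25 * √5) * hausdorffAsymmetry K ≤ fraenkelAsymmetry K ∧
    fraenkelAsymmetry K ≤ (3 * √3 + 2) * hausdorffAsymmetry K := by
  have hcomp := K.isCompact
  have hconv := K.convex
  have hne := K.nonempty
  have hw := minimalWidth_pos hcomp hK
  obtain ⟨p, hp, hpmin⟩ := exists_minimizer_hausdorffDist hcomp hne hw
  obtain ⟨q, hq, hqmin⟩ := exists_minimizer_volume_symmDiff hcomp hw
  have hα : IsLeast (hausdorffRatios K)
      (Metric.hausdorffDist K (equiTriangle p.1 p.2 (minimalWidth K)) / minimalWidth K) := by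
    refine ⟨(mem_hausdorffRatios_iff hw).2 ⟨_, _, hp, rfl⟩, fun t ht => ?_⟩
    obtain ⟨c, u, hu, rfl⟩ := (mem_hausdorffRatios_iff hw).1 ht
    exact div_le_div_of_nonneg_right (hpmin (c, u) hu) hw.le
  have hA : IsLeast (fraenkelRatios K)
      (volume.real ((K : Set Plane) ∆ equiTriangle q.1 q.2 (minimalWidth K)) / minimalWidth K ^ 2) := by
    refine ⟨(mem_fraenkelRatios_iff hw).2 ⟨_, _, hq, rfl⟩, fun t ht => ?_⟩
    obtain ⟨c, u, hu, rfl⟩ := (mem_fraenkelRatios_iff hw).1 ht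
    exact div_le_div_of_nonneg_right (hqmin (c, u) hu) (by positivity)
  rw [hausdorffAsymmetry, fraenkelAsymmetry, hα.csInf_eq, hA.csInf_eq]
  refine ⟨hα, hA, ?_, ?_⟩
  -- Start from the area minimiser, keep its normals, and compare the possibly translated triangle
  -- with the Hausdorff minimiser.
  · obtain ⟨c, hc⟩ := exists_hausdorffDist_le_volume_symmDiff hcomp hconv hne hq hw q.1
    have h1 := mul_le_mul_of_nonneg_left (hpmin (c, q.2) hq) hw.le
    rw [one_div, inv_mul_le_iff₀ (by positivity), ← mul_div_assoc, div_le_div_iff₀ hw (by positivity)]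
    nlinarith [h1.trans hc]
  · have h1 := (hqmin p hp).trans (volume_symmDiff_le_hausdorffDist hcomp hconv hne hw hp)
    rw [div_le_iff₀ (by positivity)]
    refine h1.trans_eq ?_
    field_simp
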